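/- Let $0<2k<n$ and let $\lambda=(\lambda_{ij})$ be a complex $n\times k$ matrix of rank $k$, with rows $\Lambda_i=(\lambda_{i1},\dots,\lambda_{ik})\in\mathbb{C}^k$. Let $\mathfrak F=(F^1,\dots,F^k)$ be the commuting linear vector fields $F^j(z)=\sum_{i=1}^n\lambda_{ij}z_i\,\partial/\partial z_i$ on $\mathbb{C}^n$, and consider the action of $\mathbb{C}^k$ on $\mathbb{C}^n$ that they generate, $(t\cdot z)_i=e^{\sum_j\lambda_{ij}t_j}z_i$, whose orbits are called leaves. Assume that $\mathfrak F$ is admissible: $0$ lies in the (real) convex hull of $\Lambda_1,\dots,\Lambda_n$, but for all $1\le i_1<\dots<i_{2k}\le n$ it does not lie in the convex hull of $\Lambda_{i_1},\dots,\Lambda_{i_{2k}}$. A leaf is a Siegel leaf if its closure does not contain $0$. Let $\mathcal S\subset\mathbb{C}^n$ be the union of the Siegel leaves; the space of Siegel leaves is the quotient of $\mathcal S$ by the relation of lying on the same leaf, with the quotient topology. Let $\Psi=(\psi^1,\dots,\psi^k):\mathbb{C}^n\to\mathbb{C}^k$, $$\psi^j(z)=\langle F^j(z),z\rangle=\sum_{i=1}^n\lambda_{ij}|z_i|^2,\qquad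 \mathcal T=\Psi^{-1}(0),\qquad \mathcal T^*=\mathcal T\setminus\{0\}.$$ Then: 1. $\Psi$ is a mixed map (real analytic in $z,\bar z$) and $\mathcal T$ is a mixed ICIS (isolated complete intersection singularity); that is, $\Psi(0)=0$, $n>k$, $\mathcal T$ has positive dimension at $0$, and $0$ is the only point of $\mathcal T$ at which the rank of the real Jacobian matrix of $\Psi$ is not maximal. 2. $\mathcal T^*$ is a smooth complex $(n-k)$-manifold that parametrizes the space of Siegel leaves. Precisely: $\mathcal S$ is open in $\mathbb C^n$ and contains $\mathcal T^*$; the map sending $z\in\mathcal T^*$ to the leaf through $z$ is a homeomorphism from $\mathcal T^*$ (with the topology induced from $\mathbb{C}^n$) onto the space of Siegel leaves; and $\mathcal T^*$ with this topology has the structure of a complex manifold of dimension $n-k$ for which the inclusion $\mathcal T^*\hookrightarrow\mathbb{C}^n$ is a $C^\infty$ immersion of real manifolds, and for which the map $\mathcal S\to\mathcal T^*$ that sends a point to the unique point of $\mathcal T^*$ on its leaf is a holomorphic submersion. -/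

import Mathlib

open scoped Manifold ContDiff Topology

/-! ### Mixed maps and mixed isolated complete intersection singularities -/

/-- `Cn n` is the Hermitian space `ℂⁿ`. -/
abbrev Cn (n : ℕ) : Type := EuclideanSpace ℂ (Fin n)

/-- A mixed map `ℂⁿ → ℂᵏ`: a map that is real analytic, i.e. analytic in `z` and `z̄`. -/
def IsMixedMap {n k : ℕ} (F : Cn n → Cn k) : Prop :=
  AnalyticOnNhd ℝ F Set.univ

/-- The set `Σ_F` of points where the rank of the real Jacobian of `F` is not maximal. -/
def mixedCriticalSet {n k : ℕ} (F : Cn n → Cn k) : Set (Cn n) :=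
  {a | Module.finrank ℝ (LinearMap.range (fderiv ℝ F a).toLinearMap) < min (2 * n) (2 * k)}

/-- The zero set `V_F`. -/
def mixedZeroSet {n k : ℕ} (F : Cn n → Cn k) : Set (Cn n) :=
  {z | F z = 0}

/-- `F : (ℂⁿ, 0) → (ℂᵏ, 0)` is a mixed ICIS. The dimension of the real analytic set `V_F` at the
origin is measured by the Hausdorff dimension, with which it coincides. -/
structure IsMixedICIS {n k : ℕ} (F : Cn n → Cn k) : Prop where
  isMixedMap : IsMixedMap F
  map_zero : F 0 = 0
  lt : k < n
  zeroSet_pos_dim : ∀ U ∈ 𝓝 (0 : Cn n), 0 < dimH (mixedZeroSet F ∩ U)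
  critical_inter_zeroSet : mixedCriticalSet F ∩ mixedZeroSet F = {0}

/-! ### Diagonal linear actions of `ℂᵏ` on `ℂⁿ` -/

section

variable {n k : ℕ} (lam : Matrix (Fin n) (Fin k) ℂ)

/-- The vector `Λ_i = (λ_{i1}, …, λ_{ik}) ∈ ℂᵏ`. -/
def eigenvec (i : Fin n) : Cn k := WithLp.toLp 2 (lam i)

/-- The linear vector field `F^j = ∑_i λ_{ij} z_i ∂/∂z_i`. -/
noncomputable def linField (j : Fin k) (z : Cn n) : Cn n :=
  WithLp.toLp 2 fun i => lam i j * z i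

/-- The action of `ℂᵏ` on `ℂⁿ` generated by the commuting fields `F^1, …, F^k`. -/
noncomputable def linAct (t : Cn k) (z : Cn n) : Cn n :=
  WithLp.toLp 2 fun i => Complex.exp (∑ j, lam i j * t j) * z i

theorem linAct_zero (z : Cn n) : linAct lam 0 z = z := by
  ext i
  simp [linAct]

theorem linAct_add (s t : Cn k) (z : Cn n) :
    linAct lam (s + t) z = linAct lam s (linAct lam t z) := by
  ext i
  simp [linAct, mul_add, Finset.sum_add_distrib, Complex.exp_add, mul_assoc]

/-- The `j`-th one-parameter subgroup of the action is the flow of `F^j`. -/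
theorem hasDerivAt_linAct (j : Fin k) (z : Cn n) (s : ℂ) :
    HasDerivAt (fun s : ℂ => linAct lam (EuclideanSpace.single j s) z)
      (linField lam j (linAct lam (EuclideanSpace.single j s) z)) s := by
  suffices h : HasDerivAt (fun (s : ℂ) (i : Fin n) => linAct lam (EuclideanSpace.single j s) z i)
      (fun i => linField lam j (linAct lam (EuclideanSpace.single j s) z) i) s from
    (EuclideanSpace.equiv (Fin n) ℂ).symm.toContinuousLinearMap.hasFDerivAt.comp_hasDerivAt s h
  refine hasDerivAt_pi.2 fun i => ?_
  have h1 : HasDerivAt (fun s : ℂ => lam i j * s) (lam i j) s := by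
    simpa using (hasDerivAt_id s).const_mul (lam i j)
  have h2 := (h1.cexp).mul_const (z i)
  have h3 : ∀ s : ℂ, ∑ l, lam i l * (EuclideanSpace.single j s : Cn k) l = lam i j * s := by
    intro s
    rw [Finset.sum_eq_single j]
    · simp
    · intro b _ hb
      simp [hb]
    · simp
  simp only [linAct, linField, h3]
  exact h2.congr_deriv (by ring)

/-- The action is in the Siegel domain: `0` lies in the convex hull of `Λ_1, …, Λ_n`. -/
def InSiegelDomain : Prop :=
  (0 : Cn k) ∈ convexHull ℝ (Set.range (eigenvec lam))

/-- Weak hyperbolicity: `0` is in the convex hull of no `2k` of the vectors `Λ_i`. -/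
def IsWeaklyHyperbolic : Prop :=
  ∀ i : Fin (2 * k) → Fin n, StrictMono i →
    (0 : Cn k) ∉ convexHull ℝ (Set.range fun m => eigenvec lam (i m))

/-- The frame `(F^1, …, F^k)` is admissible. -/
structure IsAdmissible : Prop where
  siegel : InSiegelDomain lam
  weaklyHyperbolic : IsWeaklyHyperbolic lam

/-- The leaf (orbit) through `z`. -/
def leaf (z : Cn n) : Set (Cn n) :=
  Set.range fun t : Cn k => linAct lam t z

/-- The union of the Siegel leaves, i.e. of the leaves whose closure does not contain `0`. -/
def siegelSet : Set (Cn n) :=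
  {z | (0 : Cn n) ∉ closure (leaf lam z)}

/-- The space of Siegel leaves: the quotient of the union of the Siegel leaves by the relation of
lying on the same leaf. It carries the quotient topology. -/
abbrev SiegelLeafSpace : Type :=
  Quotient (Setoid.ker fun z : siegelSet lam => leaf lam (z : Cn n))

/-- The map `Ψ = (ψ^1, …, ψ^k)`, `ψ^j(z) = ∑_i λ_{ij} |z_i|²`. -/
noncomputable def siegelMap (z : Cn n) : Cn k :=
  WithLp.toLp 2 fun j => ∑ i, lam i j * ((‖z i‖ ^ 2 : ℝ) : ℂ)

/-- `ψ^j(z)` is the Hermitian product `⟨F^j(z), z⟩`; Mathlib's product is linear in its second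
argument. -/
theorem siegelMap_apply (z : Cn n) (j : Fin k) :
    siegelMap lam z j = inner ℂ z (linField lam j z) := by
  simp only [siegelMap, linField, PiLp.inner_apply, RCLike.inner_apply]
  refine Finset.sum_congr rfl fun i _ => ?_
  rw [mul_assoc, Complex.mul_conj, Complex.normSq_eq_norm_sq]

/-- `𝒯* = Ψ⁻¹(0) ∖ {0}`, used as a type with the topology induced from `ℂⁿ`. -/
def siegelStar : Set (Cn n) :=
  mixedZeroSet (siegelMap lam) \ {0}

end

/-!
Along a leaf, `‖t · z‖² = ∑ᵢ |zᵢ|² exp (2 Re ∑ⱼ λᵢⱼ tⱼ)` is a convex function of `t` whose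
derivative at `t = 0` is given by `Ψ(z)`. Hence `𝒯` consists of the points of minimal norm on their
leaf, as in the Kempf–Ness theorem, and every leaf through `𝒯*` is a Siegel leaf. By Carathéodory's
theorem, weak hyperbolicity implies that the `Λᵢ` in any nontrivial relation with nonnegative
coefficients span `ℂᵏ` over `ℝ`. This makes the function strictly convex on the leaves through `𝒯*`
and proper on all Siegel leaves, so that each Siegel leaf meets `𝒯*` in exactly one point. It also
makes the derivative of `Ψ` along the leaves invertible on `𝒯*`; thus `Ψ` is a submersion there, and
by the implicit function theorem the time at which a leaf reaches `𝒯*` is real analytic. Holomorphic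
charts `(t, x) ↦ t · τ(x)` straightening the leaves provide the complex structure on `𝒯*`: in such a
chart the projection to `𝒯*` along the leaves is `(t, x) ↦ x`.
-/

section SubmersionCharts

variable {𝕜 E F G X : Type*} [NontriviallyNormedField 𝕜] [NormedAddCommGroup E] [NormedSpace 𝕜 E]
  [NormedAddCommGroup F] [NormedSpace 𝕜 F] [NormedAddCommGroup G] [NormedSpace 𝕜 G]
  [TopologicalSpace X]

/-- A chart `φ` of `X` through which the map `π : E → X` becomes, at the points of `S`, a `C^m`
submersion in the sense that it has local `C^m` sections. Asking for sections rather than for a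
surjective derivative makes the notion independent of an inverse function theorem. -/
structure IsSubmersionChart (𝕜 : Type*) [NontriviallyNormedField 𝕜] [NormedSpace 𝕜 E]
    [NormedSpace 𝕜 F] (m : WithTop ℕ∞) (S : Set E) (π : E → X) (φ : OpenPartialHomeomorph X F) :
    Prop where
  contDiffAt : ∀ z ∈ S, π z ∈ φ.source → ContDiffAt 𝕜 m (φ ∘ π) z
  exists_section : ∀ z ∈ S, π z ∈ φ.source → ∃ σ : F → E,
    ContDiffAt 𝕜 m σ (φ (π z)) ∧ σ (φ (π z)) = z ∧ π ∘ σ =ᶠ[𝓝 (φ (π z))] φ.symm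

namespace IsSubmersionChart

variable {m : WithTop ℕ∞} {S : Set E} {π : E → X} {φ ψ : OpenPartialHomeomorph X F} {z : E}

theorem restrictScalars {𝕜' : Type*} [NontriviallyNormedField 𝕜'] [NormedAlgebra 𝕜' 𝕜]
    [NormedSpace 𝕜' E] [IsScalarTower 𝕜' 𝕜 E] [NormedSpace 𝕜' F] [IsScalarTower 𝕜' 𝕜 F]
    (hφ : IsSubmersionChart 𝕜 m S π φ) : IsSubmersionChart 𝕜' m S π φ where
  contDiffAt z hz hπz := (hφ.contDiffAt z hz hπz).restrict_scalars 𝕜'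
  exists_section z hz hπz :=
    let ⟨σ, hσ, hσz, hπσ⟩ := hφ.exists_section z hz hπz
    ⟨σ, hσ.restrict_scalars 𝕜', hσz, hπσ⟩

theorem contDiffAt_comp_symm (hφ : IsSubmersionChart 𝕜 m S π φ) (hz : z ∈ S)
    (hπz : π z ∈ φ.source) {f : X → G} (hf : ContDiffAt 𝕜 m (f ∘ π) z) :
    ContDiffAt 𝕜 m (f ∘ φ.symm) (φ (π z)) := by
  obtain ⟨σ, hσ, hσz, hπσ⟩ := hφ.exists_section z hz hπz
  rw [← hσz] at hf
  exact (hf.comp _ hσ).congr_of_eventuallyEq (hπσ.symm.fun_comp f)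

theorem contDiffOn_transition (hφ : IsSubmersionChart 𝕜 m S π φ)
    (hψ : IsSubmersionChart 𝕜 m S π ψ) (hπ : Set.SurjOn π S Set.univ) :
    ContDiffOn 𝕜 m (ψ ∘ φ.symm) (φ.symm ≫ₕ ψ).source := by
  rintro x hx
  obtain ⟨hxφ, hxψ⟩ : x ∈ φ.target ∧ φ.symm x ∈ ψ.source := by simpa using hx
  obtain ⟨z, hz, hπz⟩ := hπ (Set.mem_univ (φ.symm x))
  rw [← φ.right_inv hxφ, ← hπz]
  exact (hφ.contDiffAt_comp_symm hz (hπz ▸ φ.map_target hxφ)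
    (hψ.contDiffAt z hz (hπz ▸ hxψ))).contDiffWithinAt

theorem isManifold [ChartedSpace F X] (hatlas : ∀ φ ∈ atlas F X, IsSubmersionChart 𝕜 m S π φ)
    (hπ : Set.SurjOn π S Set.univ) : IsManifold 𝓘(𝕜, F) m X :=
  isManifold_of_contDiffOn _ _ _ fun φ ψ hφ hψ => by
    simpa using (hatlas φ hφ).contDiffOn_transition (hatlas ψ hψ) hπ

theorem surjective_fderiv (hφ : IsSubmersionChart 𝕜 m S π φ) (hm : m ≠ 0) (hz : z ∈ S)
    (hπz : π z ∈ φ.source) : Function.Surjective (fderiv 𝕜 (φ ∘ π) z) := by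
  obtain ⟨σ, hσ, hσz, hπσ⟩ := hφ.exists_section z hz hπz
  have hd : DifferentiableAt 𝕜 (φ ∘ π) (σ (φ (π z))) := by
    rw [hσz]
    exact (hφ.contDiffAt z hz hπz).differentiableAt hm
  have hid : (φ ∘ π) ∘ σ =ᶠ[𝓝 (φ (π z))] id := by
    filter_upwards [hπσ, φ.open_target.mem_nhds (φ.map_source hπz)] with x hx hxφ
    exact (congrArg φ hx).trans (φ.right_inv hxφ)
  have hcomp := fderiv_comp _ hd (hσ.differentiableAt hm)
  rw [hid.fderiv_eq, fderiv_id, hσz] at hcomp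
  exact fun v => ⟨fderiv 𝕜 σ (φ (π z)) v, (DFunLike.congr_fun hcomp v).symm⟩

variable [ChartedSpace F X]

theorem contMDiffAt (hφ : IsSubmersionChart 𝕜 m S π (chartAt F (π z))) (hz : z ∈ S)
    (hπ : ContinuousAt π z) : ContMDiffAt 𝓘(𝕜, E) 𝓘(𝕜, F) m π z :=
  contMDiffAt_iff.2 ⟨hπ, (hφ.contDiffAt z hz (mem_chart_source F _)).contDiffWithinAt⟩

theorem surjective_mfderiv (hφ : IsSubmersionChart 𝕜 m S π (chartAt F (π z))) (hm : m ≠ 0)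
    (hz : z ∈ S) (hπ : ContinuousAt π z) :
    Function.Surjective (mfderiv 𝓘(𝕜, E) 𝓘(𝕜, F) π z) := by
  rw [((hφ.contMDiffAt hz hπ).mdifferentiableAt hm).mfderiv, modelWithCornersSelf_coe,
    Set.range_id, fderivWithin_univ]
  exact hφ.surjective_fderiv hm hz (mem_chart_source F _)

theorem contMDiffAt_of_comp (hφ : IsSubmersionChart 𝕜 m S π (chartAt F (π z))) (hz : z ∈ S)
    {f : X → G} (hfc : ContinuousAt f (π z)) (hf : ContDiffAt 𝕜 m (f ∘ π) z) :
    ContMDiffAt 𝓘(𝕜, F) 𝓘(𝕜, G) m f (π z) :=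
  contMDiffAt_iff.2 ⟨hfc,
    (hφ.contDiffAt_comp_symm hz (mem_chart_source F _) hf).contDiffWithinAt⟩

theorem injective_mfderiv_of_leftInverse {ι : X → E} {x : X} (hπι : Function.LeftInverse π ι)
    (hφ : IsSubmersionChart 𝕜 m S π (chartAt F x)) (hm : m ≠ 0) (hx : ι x ∈ S)
    (hι : ContMDiffAt 𝓘(𝕜, F) 𝓘(𝕜, E) m ι x) :
    Function.Injective (mfderiv 𝓘(𝕜, F) 𝓘(𝕜, E) ι x) := by
  rw [(hι.mdifferentiableAt hm).mfderiv, modelWithCornersSelf_coe, Set.range_id, fderivWithin_univ]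
  set φ := chartAt F x
  have hxφ : x ∈ φ.source := mem_chart_source F x
  have hd : DifferentiableAt 𝕜 (ι ∘ φ.symm) (φ x) :=
    ((contMDiffAt_iff.1 hι).2.contDiffAt (by simp)).differentiableAt hm
  have hdφ : DifferentiableAt 𝕜 (φ ∘ π) ((ι ∘ φ.symm) (φ x)) := by
    rw [Function.comp_apply, φ.left_inv hxφ]
    exact (hφ.contDiffAt (ι x) hx ((hπι x).symm ▸ hxφ)).differentiableAt hm
  have hid : (φ ∘ π) ∘ ι ∘ φ.symm =ᶠ[𝓝 (φ x)] id := by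
    filter_upwards [φ.open_target.mem_nhds (φ.map_source hxφ)] with y hy
    exact (congrArg φ (hπι _)).trans (φ.right_inv hy)
  have hcomp := fderiv_comp _ hdφ hd
  rw [hid.fderiv_eq, fderiv_id] at hcomp
  exact Function.LeftInverse.injective fun v => (DFunLike.congr_fun hcomp v).symm

end IsSubmersionChart

end SubmersionCharts

section Convexity

variable {ι V : Type*} [AddCommGroup V] [Module ℝ V] {v : ι → V}

theorem exists_finset_card_le_finrank_span_of_mem_convexHull [FiniteDimensional ℝ V]
    {I : Set ι} {x : V} (hx : x ∈ convexHull ℝ (v '' I)) :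
    ∃ t : Finset ι, t.card ≤ Module.finrank ℝ (Submodule.span ℝ (v '' I)) + 1 ∧
      x ∈ convexHull ℝ (v '' t) := by
  classical
  rw [convexHull_eq_union] at hx
  simp only [Set.mem_iUnion] at hx
  obtain ⟨T, hTI, hT, hxT⟩ := hx
  obtain ⟨t, -, ht, rfl⟩ := Finset.exists_subset_injOn_image_eq_of_surjOn I T hTI
  refine ⟨t, ?_, by rwa [← Finset.coe_image]⟩
  have hspan : vectorSpan ℝ (Set.range ((↑) : t.image v → V)) ≤ Submodule.span ℝ (v '' I) := by
    rw [vectorSpan_def, Submodule.span_le]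
    rintro _ ⟨_, ⟨a, rfl⟩, _, ⟨b, rfl⟩, rfl⟩
    exact sub_mem (Submodule.subset_span (hTI a.2)) (Submodule.subset_span (hTI b.2))
  calc t.card = Fintype.card (t.image v) := by
        rw [Fintype.card_coe, Finset.card_image_of_injOn ht]
    _ ≤ Module.finrank ℝ (vectorSpan ℝ (Set.range ((↑) : t.image v → V))) + 1 :=
        hT.card_le_finrank_succ
    _ ≤ _ := Nat.add_le_add_right (Submodule.finrank_mono hspan) 1

variable [Fintype ι]

theorem zero_mem_convexHull_image_iff {I : Set ι} :
    0 ∈ convexHull ℝ (v '' I) ↔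
      ∃ c : ι → ℝ, 0 ≤ c ∧ c ≠ 0 ∧ Function.support c ⊆ I ∧ ∑ i, c i • v i = 0 := by
  constructor
  · intro h
    have := Classical.decEq ι
    obtain ⟨κ, _, w, x, hw0, hw1, hx, hwx⟩ := mem_convexHull_iff_exists_fintype.1 h
    choose idx hidx hvidx using hx
    refine ⟨fun i => ∑ a with idx a = i, w a, fun i => Finset.sum_nonneg fun a _ => hw0 a, ?_, ?_,
      ?_⟩
    · intro h0
      have hsum : ∑ i, ∑ a with idx a = i, w a = 1 := by rw [Finset.sum_fiberwise, hw1]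
      exact zero_ne_one ((Finset.sum_eq_zero fun i _ => congrFun h0 i).symm.trans hsum)
    · intro i hi
      obtain ⟨a, ha, -⟩ := Finset.exists_ne_zero_of_sum_ne_zero hi
      exact (Finset.mem_filter.1 ha).2 ▸ hidx a
    · rw [← hwx, ← Finset.sum_fiberwise Finset.univ idx]
      refine Finset.sum_congr rfl fun i _ => ?_
      rw [Finset.sum_smul]
      refine Finset.sum_congr rfl fun a ha => ?_
      rw [← hvidx a, (Finset.mem_filter.1 ha).2]
  · rintro ⟨c, hc0, hcne, hcI, hcv⟩
    have hpos : 0 < ∑ i with c i ≠ 0, c i := by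
      rw [Finset.sum_filter_ne_zero]
      exact (Finset.sum_nonneg fun i _ => hc0 i).lt_of_ne' fun h =>
        hcne ((Fintype.sum_eq_zero_iff_of_nonneg hc0).1 h)
    have hmem := Finset.centerMass_mem_convexHull (s := v '' I) (Finset.univ.filter (c · ≠ 0))
      (fun i _ => hc0 i) hpos
      (fun i hi => Set.mem_image_of_mem v (hcI (Finset.mem_filter.1 hi).2))
    rwa [Finset.centerMass_filter_ne_zero, Finset.centerMass, hcv, smul_zero] at hmem

/-- The members of `v` entering any nontrivial vanishing nonnegative combination of the family
span the whole space. This is the form in which weak hyperbolicity is used. -/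
def NonnegRelationsSpan (v : ι → V) : Prop :=
  ∀ c : ι → ℝ, 0 ≤ c → c ≠ 0 → ∑ i, c i • v i = 0 →
    Submodule.span ℝ (v '' Function.support c) = ⊤

theorem nonnegRelationsSpan_of_notMem_convexHull [FiniteDimensional ℝ V]
    (hι : Module.finrank ℝ V ≤ Fintype.card ι)
    (h : ∀ t : Finset ι, t.card = Module.finrank ℝ V → (0 : V) ∉ convexHull ℝ (v '' t)) :
    NonnegRelationsSpan v := by
  intro c hc0 hcne hcv
  by_contra hspan
  obtain ⟨t, ht, h0t⟩ := exists_finset_card_le_finrank_span_of_mem_convexHull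
    (zero_mem_convexHull_image_iff.2 ⟨c, hc0, hcne, subset_rfl, hcv⟩)
  obtain ⟨J, htJ, hJ⟩ := Finset.exists_superset_card_eq
    (ht.trans (Submodule.finrank_lt hspan)) hι
  exact h J hJ (convexHull_mono (Set.image_mono (Finset.coe_subset.2 htJ)) h0t)

end Convexity

theorem IsWeaklyHyperbolic.nonnegRelationsSpan {n k : ℕ} {lam : Matrix (Fin n) (Fin k) ℂ}
    (h : IsWeaklyHyperbolic lam) (hkn : 2 * k ≤ n) : NonnegRelationsSpan (eigenvec lam) := by
  have hdim : Module.finrank ℝ (Cn k) = 2 * k := by simp [finrank_real_of_complex]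
  refine nonnegRelationsSpan_of_notMem_convexHull (by simpa [hdim] using hkn) fun t ht => ?_
  have himage : Set.range (fun m => eigenvec lam (t.orderEmbOfFin (ht.trans hdim) m)) =
      eigenvec lam '' t := by
    rw [← Finset.range_orderEmbOfFin t (ht.trans hdim), ← Set.range_comp, Function.comp_def]
  exact himage ▸ h _ (OrderEmbedding.strictMono _)

section ExponentialSums

variable {ι : Type*} {p x : ι → ℝ}

theorem exists_pos_le_mul_of_support_subset [Finite ι] {c : ι → ℝ} (hc : 0 ≤ c)
    (hp : 0 ≤ p) (hcp : Function.support c ⊆ Function.support p) : ∃ M > 0, ∀ i, c i ≤ M * p i := by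
  cases nonempty_fintype ι
  have hdiv : ∀ i, 0 ≤ c i / p i := fun i => div_nonneg (hc i) (hp i)
  have hsum : 0 ≤ ∑ i, c i / p i := Finset.sum_nonneg fun i _ => hdiv i
  refine ⟨∑ i, c i / p i + 1, by positivity, fun i => ?_⟩
  by_cases hi : c i = 0
  · rw [hi]
    exact mul_nonneg (by positivity) (hp i)
  · rw [← div_le_iff₀ ((hp i).lt_of_ne' (hcp hi))]
    exact (Finset.single_le_sum (fun i _ => hdiv i) (Finset.mem_univ i)).trans (by simp)

variable [Fintype ι]

theorem sum_le_sum_mul_exp (hp : 0 ≤ p) (hx : ∑ i, p i * x i = 0) :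
    ∑ i, p i ≤ ∑ i, p i * Real.exp (x i) :=
  calc ∑ i, p i = ∑ i, p i * (x i + 1) := by simp [mul_add, Finset.sum_add_distrib, hx]
    _ ≤ ∑ i, p i * Real.exp (x i) := Finset.sum_le_sum fun i _ =>
      mul_le_mul_of_nonneg_left (Real.add_one_le_exp _) (hp i)

theorem eq_zero_of_sum_mul_exp_le (hp : 0 ≤ p) (hx : ∑ i, p i * x i = 0)
    (h : ∑ i, p i * Real.exp (x i) ≤ ∑ i, p i) {i : ι} (hi : p i ≠ 0) : x i = 0 := by
  have hnonneg : 0 ≤ fun i => p i * (Real.exp (x i) - (x i + 1)) := fun i =>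
    mul_nonneg (hp i) (sub_nonneg.2 (Real.add_one_le_exp _))
  have hsum : ∑ i, p i * (Real.exp (x i) - (x i + 1)) = 0 := by
    refine le_antisymm ?_ (Finset.sum_nonneg fun i _ => hnonneg i)
    simpa [mul_sub, mul_add, Finset.sum_add_distrib, hx] using h
  have hzero := congrFun ((Fintype.sum_eq_zero_iff_of_nonneg hnonneg).1 hsum) i
  have hexp : Real.exp (x i) = x i + 1 :=
    sub_eq_zero.1 ((mul_eq_zero.1 hzero).resolve_left hi)
  by_contra hne
  exact (Real.add_one_lt_exp hne).ne' hexp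

theorem sum_mul_eq_zero_of_forall_sum_le
    (h : ∀ s : ℝ, ∑ i, p i ≤ ∑ i, p i * Real.exp (s * x i)) : ∑ i, p i * x i = 0 := by
  have hmin : IsLocalMin (fun s : ℝ => ∑ i, p i * Real.exp (s * x i)) 0 :=
    Filter.Eventually.of_forall fun s => by simpa using h s
  have hderiv : HasDerivAt (fun s : ℝ => ∑ i, p i * Real.exp (s * x i))
      (∑ i, p i * (Real.exp (0 * x i) * (1 * x i))) 0 :=
    HasDerivAt.fun_sum fun i _ => (((hasDerivAt_id (0 : ℝ)).mul_const _).exp).const_mul _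
  simpa using hmin.hasDerivAt_eq_zero hderiv

theorem abs_add_self_le_two_mul_exp (a : ℝ) : |a| + a ≤ 2 * Real.exp a := by
  rcases abs_cases a with ⟨ha, -⟩ | ⟨ha, -⟩ <;>
    linarith [Real.add_one_le_exp a, Real.exp_pos a]

theorem tendsto_sum_mul_exp_cocompact {V : Type*} [NormedAddCommGroup V] [NormedSpace ℝ V]
    [FiniteDimensional ℝ V] {φ : ι → V →ₗ[ℝ] ℝ} {c : ι → ℝ} (hc : 0 ≤ c)
    (hcφ : ∀ v, ∑ i, c i * φ i v = 0) (hφ : ∀ v, (∀ i ∈ Function.support c, φ i v = 0) → v = 0)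
    (hp : 0 ≤ p) (hcp : Function.support c ⊆ Function.support p) :
    Filter.Tendsto (fun v => ∑ i, p i * Real.exp (φ i v)) (Filter.cocompact V) Filter.atTop := by
  obtain ⟨M, hM, hcM⟩ := exists_pos_le_mul_of_support_subset hc hp hcp
  let L : V →ₗ[ℝ] ι → ℝ := LinearMap.pi fun i => c i • φ i
  have hL : LinearMap.ker L = ⊥ := LinearMap.ker_eq_bot'.2 fun v hv =>
    hφ v fun i hi => (mul_eq_zero.1 (congrFun hv i)).resolve_left hi
  have hbound : ∀ v, ‖L v‖ ≤ 2 * M * ∑ i, p i * Real.exp (φ i v) := fun v =>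
    calc ‖L v‖ ≤ ∑ i, ‖L v i‖ :=
        (pi_norm_le_iff_of_nonneg (Finset.sum_nonneg fun i _ => norm_nonneg _)).2 fun i =>
          Finset.single_le_sum (f := fun i => ‖L v i‖) (fun i _ => norm_nonneg _)
            (Finset.mem_univ i)
      _ = ∑ i, c i * |φ i v| := by simp [L, abs_of_nonneg (hc _)]
      -- Adding the vanishing sum `∑ c_i φ_i v` leaves only the positive parts of the `φ_i v`.
      _ = ∑ i, c i * (|φ i v| + φ i v) := by simp [mul_add, Finset.sum_add_distrib, hcφ]
      _ ≤ ∑ i, M * p i * (2 * Real.exp (φ i v)) := Finset.sum_le_sum fun i _ =>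
        mul_le_mul (hcM i) (abs_add_self_le_two_mul_exp _) (by linarith [neg_abs_le (φ i v)])
          (mul_nonneg hM.le (hp i))
      _ = 2 * M * ∑ i, p i * Real.exp (φ i v) := by
        rw [Finset.mul_sum]
        exact Finset.sum_congr rfl fun i _ => by ring
  refine (Filter.tendsto_const_mul_atTop_of_pos (mul_pos two_pos hM)).1
    (Filter.tendsto_atTop_mono hbound ?_)
  exact tendsto_norm_cocompact_atTop.comp
    (LinearMap.isClosedEmbedding_of_injective hL).tendsto_cocompact

end ExponentialSums

theorem dimH_inter_pos_of_smul_mem {E : Type*} [NormedAddCommGroup E] [NormedSpace ℝ E]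
    {A U : Set E} {w : E} (hw : w ≠ 0) (hA : ∀ r : ℝ, r • w ∈ A) (hU : U ∈ 𝓝 0) :
    0 < dimH (A ∩ U) := by
  let L : ℝ →L[ℝ] E := ContinuousLinearMap.toSpanSingleton ℝ w
  obtain ⟨K, -, hK⟩ := L.toLinearMap.exists_antilipschitzWith (LinearMap.ker_toSpanSingleton ℝ hw)
  have hLU : L ⁻¹' U ∈ 𝓝 0 := L.continuous.continuousAt.preimage_mem_nhds (by simpa using hU)
  have hsub : L '' (L ⁻¹' U) ⊆ A ∩ U := by
    rintro _ ⟨r, hr, rfl⟩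
    exact ⟨by simpa [L] using hA r, hr⟩
  calc (0 : ENNReal) < dimH (L ⁻¹' U) := by simp [Real.dimH_of_mem_nhds hLU]
    _ ≤ dimH (L '' (L ⁻¹' U)) := hK.le_dimH_image _
    _ ≤ dimH (A ∩ U) := dimH_mono hsub

theorem exists_prodEquiv_extending_of_injective {𝕜 V W E : Type*} [NontriviallyNormedField 𝕜]
    [CompleteSpace 𝕜] [NormedAddCommGroup V] [NormedSpace 𝕜 V] [FiniteDimensional 𝕜 V]
    [NormedAddCommGroup W] [NormedSpace 𝕜 W] [FiniteDimensional 𝕜 W]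
    [NormedAddCommGroup E] [NormedSpace 𝕜 E] [FiniteDimensional 𝕜 E]
    {L : V →L[𝕜] E} (hL : Function.Injective L)
    (hdim : Module.finrank 𝕜 V + Module.finrank 𝕜 W = Module.finrank 𝕜 E) :
    ∃ (B : W →L[𝕜] E) (e : (V × W) ≃L[𝕜] E), (e : V × W →L[𝕜] E) = L.coprod B := by
  obtain ⟨N, hN⟩ := Submodule.exists_isCompl (LinearMap.range L.toLinearMap)
  have hfinrank : Module.finrank 𝕜 W = Module.finrank 𝕜 N := by
    have hadd := Submodule.finrank_add_eq_of_isCompl hN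
    rw [LinearMap.finrank_range_of_inj hL] at hadd
    omega
  let b : W ≃ₗ[𝕜] N := LinearEquiv.ofFinrankEq W N hfinrank
  let e : (V × W) ≃ₗ[𝕜] E :=
    (LinearEquiv.ofInjective L.toLinearMap hL).prodCongr b ≪≫ₗ Submodule.prodEquivOfIsCompl _ _ hN
  exact ⟨(N.subtype ∘ₗ b).toContinuousLinearMap, e.toContinuousLinearEquiv, by ext p <;> simp [e]⟩

section Action

variable {n k : ℕ} (lam : Matrix (Fin n) (Fin k) ℂ)

/-- The linear form `t ↦ ∑_j λ_{ij} t_j`, through which `ℂᵏ` acts on the `i`-th coordinate. -/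
noncomputable def weight (i : Fin n) : Cn k →L[ℂ] ℂ :=
  ∑ j, lam i j • (EuclideanSpace.proj j : Cn k →L[ℂ] ℂ)

theorem weight_apply (i : Fin n) (t : Cn k) : weight lam i t = ∑ j, lam i j * t j := by
  simp [weight]

theorem linAct_apply (t : Cn k) (z : Cn n) (i : Fin n) :
    linAct lam t z i = Complex.exp (weight lam i t) * z i := by
  simp [linAct, weight_apply]

/-- The real linear form `t ↦ 2 Re ∑_j λ_{ij} t_j`, i.e. the exponent with which `|z_i|²` grows
under the action. -/
noncomputable def growthRate (i : Fin n) : Cn k →L[ℝ] ℝ :=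
  (2 : ℝ) • Complex.reCLM ∘L (weight lam i).restrictScalars ℝ

theorem growthRate_apply (i : Fin n) (t : Cn k) : growthRate lam i t = 2 * (weight lam i t).re :=
  rfl

theorem norm_sq_linAct_apply (t : Cn k) (z : Cn n) (i : Fin n) :
    ‖linAct lam t z i‖ ^ 2 = ‖z i‖ ^ 2 * Real.exp (growthRate lam i t) := by
  rw [linAct_apply, norm_mul, Complex.norm_exp, mul_pow, ← Real.exp_nat_mul, growthRate_apply,
    Nat.cast_ofNat, mul_comm]

theorem norm_sq_linAct (t : Cn k) (z : Cn n) :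
    ‖linAct lam t z‖ ^ 2 = ∑ i, ‖z i‖ ^ 2 * Real.exp (growthRate lam i t) := by
  simp only [EuclideanSpace.norm_sq_eq, norm_sq_linAct_apply]

theorem linAct_eq_zero {t : Cn k} {z : Cn n} : linAct lam t z = 0 ↔ z = 0 := by
  simp [PiLp.ext_iff, linAct_apply]

theorem linAct_neg_linAct (t : Cn k) (z : Cn n) : linAct lam (-t) (linAct lam t z) = z := by
  rw [← linAct_add, neg_add_cancel, linAct_zero]

theorem mem_leaf_self (z : Cn n) : z ∈ leaf lam z := ⟨0, linAct_zero lam z⟩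

theorem leaf_linAct (t : Cn k) (z : Cn n) : leaf lam (linAct lam t z) = leaf lam z := by
  simp only [leaf, ← linAct_add]
  exact (Equiv.addRight t).surjective.range_comp fun s => linAct lam s z

theorem linAct_mem_siegelSet {t : Cn k} {z : Cn n} :
    linAct lam t z ∈ siegelSet lam ↔ z ∈ siegelSet lam := by
  simp [siegelSet, leaf_linAct]

theorem siegelMap_eq_sum (z : Cn n) : siegelMap lam z = ∑ i, ‖z i‖ ^ 2 • eigenvec lam i := by
  ext j
  simp [siegelMap, eigenvec, mul_comm]

theorem siegelMap_smul (r : ℝ) (z : Cn n) : siegelMap lam (r • z) = r ^ 2 • siegelMap lam z := by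
  simp [siegelMap_eq_sum, Finset.smul_sum, mul_smul, mul_pow]

theorem siegelMap_zero : siegelMap lam 0 = 0 := by
  simp [siegelMap_eq_sum]

theorem siegelStar_nonempty (h : InSiegelDomain lam) : (siegelStar lam).Nonempty := by
  rw [InSiegelDomain, ← Set.image_univ] at h
  obtain ⟨c, hc0, hcne, -, hc⟩ := zero_mem_convexHull_image_iff.1 h
  have hsq : ∀ i, ‖((√(c i) : ℝ) : ℂ)‖ ^ 2 = c i := fun i => by
    rw [Complex.norm_real, Real.norm_of_nonneg (Real.sqrt_nonneg _), Real.sq_sqrt (hc0 i)]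
  refine ⟨WithLp.toLp 2 fun i => ((√(c i) : ℝ) : ℂ), ?_, fun hzero => hcne ?_⟩
  · exact (siegelMap_eq_sum lam _).trans (by simpa only [hsq] using hc)
  · ext i
    have hi : ((√(c i) : ℝ) : ℂ) = 0 := congrArg (fun z : Cn n => z i) hzero
    simpa [hi] using (hsq i).symm

/-- Coordinatewise conjugation; it turns the bilinear pairing of `ℂᵏ` with itself that occurs in
the weights into the Hermitian product. -/
noncomputable def Cn.conj (t : Cn k) : Cn k := WithLp.toLp 2 (star (WithLp.ofLp t))

theorem Cn.conj_conj (t : Cn k) : Cn.conj (Cn.conj t) = t := by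
  simp [Cn.conj]

theorem growthRate_eq_inner (i : Fin n) (t : Cn k) :
    growthRate lam i t = 2 * inner ℝ (Cn.conj t) (eigenvec lam i) := by
  simp [growthRate_apply, weight_apply, real_inner_eq_re_inner ℂ, PiLp.inner_apply, Cn.conj,
    eigenvec]

theorem sum_mul_growthRate (c : Fin n → ℝ) (t : Cn k) :
    ∑ i, c i * growthRate lam i t = 2 * inner ℝ (Cn.conj t) (∑ i, c i • eigenvec lam i) := by
  simp only [growthRate_eq_inner, inner_sum, inner_smul_right, Finset.mul_sum, mul_left_comm]

theorem sum_smul_eigenvec_eq_zero_iff {c : Fin n → ℝ} :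
    ∑ i, c i • eigenvec lam i = 0 ↔ ∀ t, ∑ i, c i * growthRate lam i t = 0 := by
  simp only [sum_mul_growthRate]
  refine ⟨fun h t => by simp [h], fun h => ?_⟩
  simpa [Cn.conj_conj] using h (Cn.conj (∑ i, c i • eigenvec lam i))

theorem siegelMap_eq_zero_iff {z : Cn n} :
    siegelMap lam z = 0 ↔ ∀ t, ∑ i, ‖z i‖ ^ 2 * growthRate lam i t = 0 := by
  rw [siegelMap_eq_sum, sum_smul_eigenvec_eq_zero_iff]

theorem eq_zero_of_growthRate_eq_zero {I : Set (Fin n)}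
    (hI : Submodule.span ℝ (eigenvec lam '' I) = ⊤) {t : Cn k}
    (ht : ∀ i ∈ I, growthRate lam i t = 0) : t = 0 := by
  have hspan : Submodule.span ℝ (eigenvec lam '' I) ≤ (ℝ ∙ Cn.conj t)ᗮ := by
    rw [Submodule.span_le]
    rintro _ ⟨i, hi, rfl⟩
    simpa [growthRate_eq_inner, Submodule.mem_orthogonal_singleton_iff_inner_right] using ht i hi
  have hconj : Cn.conj t = 0 := by
    rwa [hI, top_le_iff, Submodule.orthogonal_eq_top_iff, Submodule.span_singleton_eq_bot] at hspan
  rw [← Cn.conj_conj t, hconj]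
  ext j
  simp [Cn.conj]

theorem exists_growthRate_neg_of_notMem_convexHull {I : Set (Fin n)}
    (hI : (0 : Cn k) ∉ convexHull ℝ (eigenvec lam '' I)) :
    ∃ t, ∀ i ∈ I, growthRate lam i t < 0 := by
  obtain ⟨f, u, hu, hf⟩ := geometric_hahn_banach_point_closed (convex_convexHull ℝ _)
    ((Set.toFinite (eigenvec lam '' I)).isClosed_convexHull ℝ) hI
  rw [map_zero] at hu
  refine ⟨Cn.conj (-(InnerProductSpace.toDual ℝ (Cn k)).symm f), fun i hi => ?_⟩
  have hfi := hf _ (subset_convexHull ℝ _ (Set.mem_image_of_mem _ hi))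
  rw [growthRate_eq_inner, Cn.conj_conj, inner_neg_left, InnerProductSpace.toDual_symm_apply]
  linarith

end Action

section KempfNess

variable {n k : ℕ} {lam : Matrix (Fin n) (Fin k) ℂ} {z : Cn n}

theorem siegelMap_eq_zero_iff_forall_norm_le :
    siegelMap lam z = 0 ↔ ∀ t, ‖z‖ ≤ ‖linAct lam t z‖ := by
  have hiff : (∀ t, ‖z‖ ≤ ‖linAct lam t z‖) ↔
      ∀ t, ∑ i, ‖z i‖ ^ 2 ≤ ∑ i, ‖z i‖ ^ 2 * Real.exp (growthRate lam i t) := by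
    simp only [← norm_sq_linAct, ← EuclideanSpace.norm_sq_eq,
      sq_le_sq₀ (norm_nonneg _) (norm_nonneg _)]
  rw [siegelMap_eq_zero_iff, hiff]
  refine ⟨fun h t => sum_le_sum_mul_exp (fun i => sq_nonneg _) (h t), fun h t => ?_⟩
  exact sum_mul_eq_zero_of_forall_sum_le fun s => by simpa using h (s • t)

theorem siegelStar_subset_siegelSet : siegelStar lam ⊆ siegelSet lam := by
  intro z hz hmem
  obtain ⟨_, ⟨t, rfl⟩, ht⟩ := Metric.mem_closure_iff.1 hmem ‖z‖ (norm_pos_iff.2 hz.2)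
  rw [dist_zero_left] at ht
  exact (siegelMap_eq_zero_iff_forall_norm_le.1 hz.1 t).not_gt ht

theorem zero_mem_convexHull_of_mem_siegelSet (hz : z ∈ siegelSet lam) :
    (0 : Cn k) ∈ convexHull ℝ (eigenvec lam '' {i | z i ≠ 0}) := by
  by_contra hnot
  obtain ⟨t, ht⟩ := exists_growthRate_neg_of_notMem_convexHull lam hnot
  have hsq : Filter.Tendsto (fun s : ℝ => ‖linAct lam (s • t) z‖ ^ 2) Filter.atTop (𝓝 0) := by
    simp only [norm_sq_linAct, map_smul, smul_eq_mul]
    rw [← Finset.sum_const_zero (s := (Finset.univ : Finset (Fin n)))]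
    refine tendsto_finsetSum _ fun i _ => ?_
    by_cases hi : z i = 0
    · simp [hi]
    · rw [← mul_zero (‖z i‖ ^ 2)]
      exact (Real.tendsto_exp_atBot.comp
        (Filter.tendsto_id.atTop_mul_const_of_neg (ht i hi))).const_mul _
  have hlim : Filter.Tendsto (fun s : ℝ => linAct lam (s • t) z) Filter.atTop (𝓝 0) :=
    tendsto_zero_iff_norm_tendsto_zero.2 (by simpa [Real.sqrt_sq] using hsq.sqrt)
  exact hz (mem_closure_of_tendsto hlim (Filter.Eventually.of_forall fun s => ⟨_, rfl⟩))

theorem contDiffAt_linAct {E : Type*} [NormedAddCommGroup E] [NormedSpace ℂ E] {m : WithTop ℕ∞}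
    {x : E} {f : E → Cn k} {g : E → Cn n} (hf : ContDiffAt ℂ m f x) (hg : ContDiffAt ℂ m g x) :
    ContDiffAt ℂ m (fun y => linAct lam (f y) (g y)) x := by
  refine contDiffAt_piLp' 2 fun i => ?_
  simp only [linAct_apply]
  exact (((weight lam i).contDiff.contDiffAt.comp x hf).cexp).mul
    ((EuclideanSpace.proj i : Cn n →L[ℂ] ℂ).contDiff.contDiffAt.comp x hg)

theorem contDiff_linAct {m : WithTop ℕ∞} :
    ContDiff ℂ m fun p : Cn k × Cn n => linAct lam p.1 p.2 :=
  contDiff_iff_contDiffAt.2 fun _ => contDiffAt_linAct contDiffAt_fst contDiffAt_snd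

namespace NonnegRelationsSpan

variable (h : NonnegRelationsSpan (eigenvec lam))
include h

theorem eq_zero_of_growthRate_eq_zero (hz : z ∈ siegelStar lam) {t : Cn k}
    (ht : ∀ i, z i ≠ 0 → growthRate lam i t = 0) : t = 0 := by
  refine _root_.eq_zero_of_growthRate_eq_zero lam
    (h (fun i => ‖z i‖ ^ 2) (fun i => sq_nonneg _) (fun h0 => hz.2 ?_) ?_) fun i hi => ht i ?_
  · ext i
    simpa using congrFun h0 i
  · rw [← siegelMap_eq_sum]
    exact hz.1
  · simpa using hi

theorem eq_zero_of_linAct_mem_siegelStar (hz : z ∈ siegelStar lam) {t : Cn k}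
    (ht : linAct lam t z ∈ siegelStar lam) : t = 0 := by
  have hle : ‖linAct lam t z‖ ^ 2 ≤ ‖z‖ ^ 2 := by
    gcongr
    simpa [linAct_neg_linAct] using siegelMap_eq_zero_iff_forall_norm_le.1 ht.1 (-t)
  rw [norm_sq_linAct, EuclideanSpace.norm_sq_eq] at hle
  exact h.eq_zero_of_growthRate_eq_zero hz fun i hi => eq_zero_of_sum_mul_exp_le
    (fun i => sq_nonneg _) ((siegelMap_eq_zero_iff lam).1 hz.1 t) hle (by simpa using hi)

theorem tendsto_norm_sq_linAct_cocompact (hz : z ∈ siegelSet lam) :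
    Filter.Tendsto (fun t => ‖linAct lam t z‖ ^ 2) (Filter.cocompact (Cn k)) Filter.atTop := by
  obtain ⟨c, hc0, hcne, hcz, hc⟩ :=
    zero_mem_convexHull_image_iff.1 (zero_mem_convexHull_of_mem_siegelSet hz)
  simp only [norm_sq_linAct]
  exact tendsto_sum_mul_exp_cocompact (φ := fun i => (growthRate lam i).toLinearMap) hc0
    ((sum_smul_eigenvec_eq_zero_iff lam).1 hc)
    (fun t ht => _root_.eq_zero_of_growthRate_eq_zero lam (h c hc0 hcne hc) ht)
    (fun i => sq_nonneg _) fun i hi => by simpa using hcz hi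

theorem exists_linAct_mem_siegelStar (hz : z ∈ siegelSet lam) :
    ∃ t, linAct lam t z ∈ siegelStar lam := by
  have hz0 : z ≠ 0 := by
    rintro rfl
    exact hz (subset_closure (mem_leaf_self lam 0))
  have hcont : Continuous fun t => ‖linAct lam t z‖ ^ 2 :=
    ((contDiff_linAct (m := 0)).continuous.comp (Continuous.prodMk_left z)).norm.pow 2
  obtain ⟨t₀, ht₀⟩ := hcont.exists_forall_le (h.tendsto_norm_sq_linAct_cocompact hz)
  refine ⟨t₀, siegelMap_eq_zero_iff_forall_norm_le.2 fun t => ?_, (linAct_eq_zero lam).not.2 hz0⟩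
  rw [← linAct_add]
  exact le_of_sq_le_sq (ht₀ (t + t₀)) (norm_nonneg _)

end NonnegRelationsSpan

end KempfNess

section SiegelMap

variable {n k : ℕ} {lam : Matrix (Fin n) (Fin k) ℂ} {z : Cn n}

theorem contDiff_siegelMap {m : WithTop ℕ∞} : ContDiff ℝ m (siegelMap lam) := by
  simp only [funext (siegelMap_eq_sum lam)]
  exact ContDiff.sum fun i _ => ContDiff.smul (ContDiff.norm_sq ℝ
    ((EuclideanSpace.proj i : Cn n →L[ℂ] ℂ).restrictScalars ℝ).contDiff) contDiff_const

theorem isMixedMap_siegelMap : IsMixedMap (siegelMap lam) :=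
  contDiff_omega_iff_analyticOnNhd.1 contDiff_siegelMap

theorem fderiv_siegelMap (z v : Cn n) :
    fderiv ℝ (siegelMap lam) z v = ∑ i, (2 * inner ℝ (z i) (v i)) • eigenvec lam i := by
  have hproj : ∀ i, HasFDerivAt (fun y : Cn n => ‖y i‖ ^ 2)
      (2 • (innerSL ℝ (z i)).comp ((EuclideanSpace.proj i : Cn n →L[ℂ] ℂ).restrictScalars ℝ)) z :=
    fun i => (((EuclideanSpace.proj i : Cn n →L[ℂ] ℂ).restrictScalars ℝ).hasFDerivAt).norm_sq
  have hsum := HasFDerivAt.fun_sum (u := Finset.univ) fun i _ =>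
    (hproj i).smul_const (eigenvec lam i)
  rw [← funext (siegelMap_eq_sum lam)] at hsum
  simp [hsum.fderiv, mul_add]

variable (lam) in
/-- The derivative at `t = 0` of the orbit map `t ↦ t · z`. -/
noncomputable def orbitDeriv (z : Cn n) : Cn k →L[ℂ] Cn n :=
  (EuclideanSpace.equiv (Fin n) ℂ).symm.toContinuousLinearMap.comp
    (ContinuousLinearMap.pi fun i => z i • weight lam i)

theorem orbitDeriv_apply (z : Cn n) (t : Cn k) (i : Fin n) :
    orbitDeriv lam z t i = z i * weight lam i t := rfl

theorem hasStrictFDerivAt_linAct (z : Cn n) :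
    HasStrictFDerivAt (fun p : Cn k × Cn n => linAct lam p.1 p.2)
      ((orbitDeriv lam z).coprod (.id ℂ (Cn n))) (0, z) := by
  refine (hasStrictFDerivAt_piLp 2).2 fun i => ?_
  simp only [linAct_apply]
  have hexp : HasStrictFDerivAt (fun p : Cn k × Cn n => Complex.exp (weight lam i p.1))
      ((weight lam i).comp (.fst ℂ (Cn k) (Cn n))) (0, z) := by
    simpa using ((weight lam i).hasStrictFDerivAt.comp ((0 : Cn k), z) hasStrictFDerivAt_fst).cexp
  have hcoord : HasStrictFDerivAt (fun p : Cn k × Cn n => p.2 i)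
      ((EuclideanSpace.proj i : Cn n →L[ℂ] ℂ).comp (.snd ℂ (Cn k) (Cn n))) (0, z) :=
    ((EuclideanSpace.proj i : Cn n →L[ℂ] ℂ).comp (.snd ℂ (Cn k) (Cn n))).hasStrictFDerivAt
  refine (hexp.mul hcoord).congr_fderiv ?_
  ext p <;> simp [orbitDeriv_apply]

theorem hasFDerivAt_linAct_left (z : Cn n) :
    HasFDerivAt (fun t => linAct lam t z) (orbitDeriv lam z) 0 := by
  have hpair := hasFDerivAt_prodMk_left (𝕜 := ℂ) (0 : Cn k) z
  have hcomp := HasFDerivAt.comp (f := fun t => (t, z)) (0 : Cn k)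
    (hasStrictFDerivAt_linAct (lam := lam) z).hasFDerivAt hpair
  rwa [ContinuousLinearMap.coprod_comp_inl] at hcomp

theorem fderiv_siegelMap_orbitDeriv (z : Cn n) (t : Cn k) :
    fderiv ℝ (siegelMap lam) z (orbitDeriv lam z t) =
      ∑ i, (‖z i‖ ^ 2 * growthRate lam i t) • eigenvec lam i := by
  rw [fderiv_siegelMap]
  refine Finset.sum_congr rfl fun i _ => congrArg (· • eigenvec lam i) ?_
  rw [orbitDeriv_apply, growthRate_apply, real_inner_eq_re_inner ℂ, RCLike.inner_apply,
    mul_right_comm, Complex.mul_conj, Complex.normSq_eq_norm_sq, RCLike.re_eq_complex_re,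
    Complex.re_ofReal_mul, mul_left_comm]

namespace NonnegRelationsSpan

variable (h : NonnegRelationsSpan (eigenvec lam)) (hz : z ∈ siegelStar lam)
include h hz

theorem injective_fderiv_siegelMap_comp_orbitDeriv : Function.Injective
    ((fderiv ℝ (siegelMap lam) z).comp ((orbitDeriv lam z).restrictScalars ℝ)) := by
  refine (injective_iff_map_eq_zero _).2 fun t ht => ?_
  have hsum := (sum_smul_eigenvec_eq_zero_iff lam).1
    ((fderiv_siegelMap_orbitDeriv z t).symm.trans ht) t
  have hnonneg : 0 ≤ fun i => ‖z i‖ ^ 2 * growthRate lam i t * growthRate lam i t := fun i => by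
    simp only [Pi.zero_apply, mul_assoc]
    exact mul_nonneg (sq_nonneg _) (mul_self_nonneg _)
  refine h.eq_zero_of_growthRate_eq_zero hz fun i hi => ?_
  simpa [hi] using congrFun ((Fintype.sum_eq_zero_iff_of_nonneg hnonneg).1 hsum) i

theorem injective_orbitDeriv : Function.Injective (orbitDeriv lam z) :=
  Function.Injective.of_comp (f := fderiv ℝ (siegelMap lam) z)
    (h.injective_fderiv_siegelMap_comp_orbitDeriv hz)

theorem range_fderiv_siegelMap : LinearMap.range (fderiv ℝ (siegelMap lam) z).toLinearMap = ⊤ :=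
  LinearMap.range_eq_top.2 <| Function.Surjective.of_comp <| LinearMap.injective_iff_surjective.1 <|
    h.injective_fderiv_siegelMap_comp_orbitDeriv hz

theorem exists_contDiffAt_linAct_mem_siegelStar_of_mem :
    ∃ g : Cn n → Cn k, ContDiffAt ℝ ω g z ∧ ∀ᶠ y in 𝓝 z, linAct lam (g y) y ∈ siegelStar lam := by
  let Φ : Cn n × Cn k → Cn k := fun p => siegelMap lam (linAct lam p.2 p.1)
  have hΦ : ContDiffAt ℝ ω Φ (z, 0) :=
    (contDiff_siegelMap.comp ((contDiff_linAct.restrict_scalars ℝ).comp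
      (contDiff_snd.prodMk contDiff_fst))).contDiffAt
  have hpartial : (fderiv ℝ Φ (z, 0)).comp (.inr ℝ (Cn n) (Cn k)) =
      (fderiv ℝ (siegelMap lam) z).comp ((orbitDeriv lam z).restrictScalars ℝ) := by
    have hΨ : HasFDerivAt (siegelMap lam) (fderiv ℝ (siegelMap lam) z) (linAct lam 0 z) := by
      rw [linAct_zero]
      exact ((contDiff_siegelMap (m := 1)).differentiable one_ne_zero z).hasFDerivAt
    exact ((hΦ.differentiableAt (by simp)).hasFDerivAt.comp (0 : Cn k)
      (hasFDerivAt_prodMk_right z 0)).unique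
      (hΨ.comp (0 : Cn k) ((hasFDerivAt_linAct_left z).restrictScalars ℝ))
  have hinv : ((fderiv ℝ Φ (z, 0)).comp (.inr ℝ (Cn n) (Cn k))).IsInvertible := by
    rw [hpartial]
    exact ⟨(LinearEquiv.ofInjectiveEndo _
      (h.injective_fderiv_siegelMap_comp_orbitDeriv hz)).toContinuousLinearEquiv, rfl⟩
  refine ⟨hΦ.implicitFunction (by simp) hinv, hΦ.contDiffAt_implicitFunction (by simp) hinv, ?_⟩
  filter_upwards [hΦ.eventually_apply_implicitFunction (by simp) hinv, isOpen_ne.mem_nhds hz.2]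
    with y hy hy0
  have hz0 : siegelMap lam z = 0 := hz.1
  refine ⟨hy.trans ?_, (linAct_eq_zero lam).not.2 hy0⟩
  simpa only [Φ, linAct_zero] using hz0

end NonnegRelationsSpan

theorem isMixedICIS_siegelMap (hk : 0 < k) (hkn : 2 * k < n) (h : IsAdmissible lam) :
    IsMixedICIS (siegelMap lam) where
  isMixedMap := isMixedMap_siegelMap
  map_zero := siegelMap_zero lam
  lt := by omega
  zeroSet_pos_dim U hU :=
    let ⟨w, hw, hw0⟩ := siegelStar_nonempty lam h.siegel
    dimH_inter_pos_of_smul_mem hw0 (fun r => (siegelMap_smul lam r w).trans (by simp [hw.out])) hU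
  critical_inter_zeroSet := by
    refine Set.Subset.antisymm ?_ (Set.singleton_subset_iff.2 ⟨?_, siegelMap_zero lam⟩)
    · rintro z ⟨hcrit, hz⟩
      by_contra hne
      have hrange := (h.weaklyHyperbolic.nonnegRelationsSpan hkn.le).range_fderiv_siegelMap
        (z := z) ⟨hz, hne⟩
      have hlt := hcrit.out
      rw [hrange, finrank_top, finrank_real_of_complex, finrank_euclideanSpace_fin] at hlt
      omega
    · have hzero : fderiv ℝ (siegelMap lam) 0 = 0 := by
        ext1 v
        simp [fderiv_siegelMap]
      have hrange : LinearMap.range (fderiv ℝ (siegelMap lam) 0).toLinearMap = ⊥ := by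
        rw [hzero]
        exact LinearMap.range_zero
      change Module.finrank ℝ (LinearMap.range (fderiv ℝ (siegelMap lam) 0).toLinearMap) < _
      rw [hrange, finrank_bot]
      omega

end SiegelMap

section SiegelProjection

variable {n k : ℕ} {lam : Matrix (Fin n) (Fin k) ℂ} {z : Cn n} {t : Cn k}

variable (lam) in
/-- The parameter `t` that moves `z` to a point `t · z` of `𝒯*`, given as a Hilbert choice: it has
no meaning if the leaf through `z` does not meet `𝒯*`. -/
noncomputable def siegelTime (z : Cn n) : Cn k :=
  Classical.epsilon fun t => linAct lam t z ∈ siegelStar lam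

variable (lam) in
/-- The projection to `𝒯*` along the leaves, given as a Hilbert choice: it has no meaning at `z` if
the leaf through `z` does not meet `𝒯*`. -/
noncomputable def siegelProj [Nonempty (siegelStar lam)] (z : Cn n) : siegelStar lam :=
  Classical.epsilon fun w => (w : Cn n) ∈ leaf lam z

theorem siegelProj_linAct [Nonempty (siegelStar lam)] (t : Cn k) (z : Cn n) :
    siegelProj lam (linAct lam t z) = siegelProj lam z := by
  rw [siegelProj, siegelProj, leaf_linAct]

namespace NonnegRelationsSpan

variable (h : NonnegRelationsSpan (eigenvec lam))
include h

theorem exists_contDiffAt_linAct_mem_siegelStar (hz : z ∈ siegelSet lam) :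
    ∃ g : Cn n → Cn k, ContDiffAt ℝ ω g z ∧ ∀ᶠ y in 𝓝 z, linAct lam (g y) y ∈ siegelStar lam := by
  obtain ⟨t, ht⟩ := h.exists_linAct_mem_siegelStar hz
  obtain ⟨g, hg, hmem⟩ := h.exists_contDiffAt_linAct_mem_siegelStar_of_mem ht
  have hact : ContDiffAt ℝ ω (linAct lam t) z :=
    (contDiffAt_linAct contDiffAt_const contDiffAt_id).restrict_scalars ℝ
  refine ⟨fun y => g (linAct lam t y) + t, (hg.comp z hact).add contDiffAt_const, ?_⟩
  filter_upwards [hact.continuousAt.eventually hmem] with y hy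
  rwa [linAct_add]

theorem isOpen_siegelSet : IsOpen (siegelSet lam) := by
  refine isOpen_iff_mem_nhds.2 fun z hz => ?_
  obtain ⟨g, -, hg⟩ := h.exists_contDiffAt_linAct_mem_siegelStar hz
  filter_upwards [hg] with y hy
  exact (linAct_mem_siegelSet lam).1 (siegelStar_subset_siegelSet hy)

theorem siegelTime_eq (ht : linAct lam t z ∈ siegelStar lam) : siegelTime lam z = t := by
  have hs := Classical.epsilon_spec (p := fun t => linAct lam t z ∈ siegelStar lam) ⟨t, ht⟩
  refine sub_eq_zero.1 (h.eq_zero_of_linAct_mem_siegelStar ht ?_)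
  rwa [← linAct_add, sub_add_cancel]

theorem contDiffAt_siegelTime (hz : z ∈ siegelSet lam) : ContDiffAt ℝ ω (siegelTime lam) z := by
  obtain ⟨g, hg, hmem⟩ := h.exists_contDiffAt_linAct_mem_siegelStar hz
  exact hg.congr_of_eventuallyEq (hmem.mono fun y hy => h.siegelTime_eq hy)

variable [Nonempty (siegelStar lam)]

theorem siegelProj_mem_leaf (hz : z ∈ siegelSet lam) : (siegelProj lam z : Cn n) ∈ leaf lam z :=
  let ⟨t, ht⟩ := h.exists_linAct_mem_siegelStar hz
  Classical.epsilon_spec (p := fun w : siegelStar lam => (w : Cn n) ∈ leaf lam z)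
    ⟨⟨linAct lam t z, ht⟩, t, rfl⟩

theorem coe_siegelProj (hz : z ∈ siegelSet lam) :
    (siegelProj lam z : Cn n) = linAct lam (siegelTime lam z) z := by
  obtain ⟨t, ht : linAct lam t z = siegelProj lam z⟩ := h.siegelProj_mem_leaf hz
  rw [h.siegelTime_eq (ht ▸ (siegelProj lam z).2), ht]

theorem siegelProj_coe (w : siegelStar lam) : siegelProj lam (w : Cn n) = w := by
  refine Subtype.ext ?_
  rw [h.coe_siegelProj (siegelStar_subset_siegelSet w.2),
    h.siegelTime_eq (t := 0) (by simp [linAct_zero]), linAct_zero]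

theorem contDiffAt_coe_siegelProj (hz : z ∈ siegelSet lam) :
    ContDiffAt ℝ ω (fun y => (siegelProj lam y : Cn n)) z := by
  have hlin : ContDiff ℝ ω fun p : Cn k × Cn n => linAct lam p.1 p.2 :=
    contDiff_linAct.restrict_scalars ℝ
  have hact := hlin.comp_contDiffAt z ((h.contDiffAt_siegelTime hz).prodMk contDiffAt_id)
  refine hact.congr_of_eventuallyEq ?_
  filter_upwards [h.isOpen_siegelSet.mem_nhds hz] with y hy
  exact h.coe_siegelProj hy

theorem continuousAt_siegelProj (hz : z ∈ siegelSet lam) : ContinuousAt (siegelProj lam) z :=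
  Topology.IsInducing.subtypeVal.continuousAt_iff.2 (h.contDiffAt_coe_siegelProj hz).continuousAt

theorem isHomeomorph_leaf (hsub : siegelStar lam ⊆ siegelSet lam) :
    IsHomeomorph (fun w : siegelStar lam =>
      (Quotient.mk _ ⟨w, hsub w.2⟩ : SiegelLeafSpace lam)) := by
  have hproj : ∀ z y : siegelSet lam, leaf lam (z : Cn n) = leaf lam (y : Cn n) →
      siegelProj lam (z : Cn n) = siegelProj lam y := fun z y hzy => by
    rw [siegelProj, siegelProj, hzy]
  have hcont : Continuous fun z : siegelSet lam => siegelProj lam (z : Cn n) :=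
    continuous_iff_continuousAt.2 fun z =>
      (h.continuousAt_siegelProj z.2).comp continuous_subtype_val.continuousAt
  refine isHomeomorph_iff_exists_inverse.2
    ⟨continuous_quotient_mk'.comp (continuous_subtype_val.subtype_mk _),
      Quotient.lift _ hproj, h.siegelProj_coe, ?_, hcont.quotient_lift hproj⟩
  rintro ⟨z⟩
  refine Quotient.sound ?_
  change leaf lam (siegelProj lam (z : Cn n) : Cn n) = leaf lam (z : Cn n)
  rw [h.coe_siegelProj z.2, leaf_linAct]

end NonnegRelationsSpan

end SiegelProjection

section FoliatedCharts

variable {n k : ℕ} {lam : Matrix (Fin n) (Fin k) ℂ} {w z : Cn n} {t : Cn k}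

/-- A holomorphic chart of `ℂⁿ` whose inverse has the form `(t, x) ↦ t · τ(x)`, where `τ`
parametrizes a transversal of the leaves; the leaves are locally the slices `x = const`. The
transversal is parametrized by all of `ℂⁿ⁻ᵏ`, also beyond the domain of the chart. -/
structure FoliatedChart (lam : Matrix (Fin n) (Fin k) ℂ) where
  transversal : Cn (n - k) → Cn n
  contDiff_transversal : ContDiff ℂ ω transversal
  param : OpenPartialHomeomorph (Cn k × Cn (n - k)) (Cn n)
  param_apply : ∀ p, param p = linAct lam p.1 (transversal p.2)
  contDiffAt_symm : ∀ z ∈ param.target, ContDiffAt ℂ ω param.symm z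

theorem exists_foliatedChart_of_injective_orbitDeriv
    (hw : Function.Injective (orbitDeriv lam w)) :
    ∃ c : FoliatedChart lam, w ∈ c.param.target := by
  have hkn : k ≤ n := by simpa using LinearMap.finrank_le_finrank_of_injective hw
  obtain ⟨B, e, he⟩ := exists_prodEquiv_extending_of_injective (W := Cn (n - k)) hw (by simp [hkn])
  let τ : Cn (n - k) → Cn n := fun x => w + B x
  have hτ : ContDiff ℂ ω τ := contDiff_const.add B.contDiff
  let f : Cn k × Cn (n - k) → Cn n := fun p => linAct lam p.1 (τ p.2)
  have hf0 : f 0 = w := by simp [f, τ, linAct_zero]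
  have hf : ContDiffAt ℂ ω f 0 :=
    contDiffAt_linAct contDiffAt_fst (hτ.contDiffAt.comp _ contDiffAt_snd)
  have hderiv : HasFDerivAt f (e : Cn k × Cn (n - k) →L[ℂ] Cn n) 0 := by
    have hact : HasFDerivAt (fun p : Cn k × Cn n => linAct lam p.1 p.2)
        ((orbitDeriv lam w).coprod (.id ℂ (Cn n))) (0, τ 0) := by
      simpa [τ] using (hasStrictFDerivAt_linAct w).hasFDerivAt
    have hpair : HasFDerivAt (fun p : Cn k × Cn (n - k) => (p.1, τ p.2))
        ((ContinuousLinearMap.id ℂ (Cn k)).prodMap B) 0 :=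
      hasFDerivAt_fst.prodMk ((B.hasFDerivAt.const_add w).comp _ hasFDerivAt_snd)
    rw [he]
    refine (HasFDerivAt.comp (0 : Cn k × Cn (n - k)) hact hpair).congr_fderiv ?_
    ext p <;> simp
  let q := hf.toOpenPartialHomeomorph f hderiv (by simp)
  have hwq : w ∈ q.target := hf0 ▸ hf.image_mem_toOpenPartialHomeomorph_target hderiv (by simp)
  have hanalytic := (hf.to_localInverse hderiv (by simp)).analyticAt
  rw [hf0] at hanalytic
  exact ⟨{
    transversal := τ
    contDiff_transversal := hτ
    param := (q.symm.restrOpen {z | AnalyticAt ℂ q.symm z} (isOpen_analyticAt ℂ q.symm)).symm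
    param_apply := fun _ => rfl
    contDiffAt_symm := fun z hz => AnalyticAt.contDiffAt hz.2 }, hwq, hanalytic⟩

namespace FoliatedChart

variable (c : FoliatedChart lam)

/-- The transversal coordinate `x` of the point `t · τ(x)`. -/
noncomputable def coord (z : Cn n) : Cn (n - k) := (c.param.symm z).2

theorem contDiffAt_coord (hz : z ∈ c.param.target) : ContDiffAt ℂ ω c.coord z :=
  (c.contDiffAt_symm z hz).snd

theorem coord_linAct_transversal {x : Cn (n - k)} (hx : (t, x) ∈ c.param.source) :
    c.coord (linAct lam t (c.transversal x)) = x := by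
  rw [coord, ← c.param_apply (t, x), c.param.left_inv hx]

theorem linAct_transversal_coord (hz : z ∈ c.param.target) :
    linAct lam (c.param.symm z).1 (c.transversal (c.coord z)) = z := by
  rw [coord, ← c.param_apply, c.param.right_inv hz]

theorem coord_linAct (hz : z ∈ c.param.target)
    (ht : (t + (c.param.symm z).1, c.coord z) ∈ c.param.source) :
    c.coord (linAct lam t z) = c.coord z := by
  rw [← c.coord_linAct_transversal ht, linAct_add, c.linAct_transversal_coord hz]

theorem siegelTime_transversal_coord (h : NonnegRelationsSpan (eigenvec lam))
    (hz : z ∈ c.param.target) (hzs : z ∈ siegelStar lam) :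
    siegelTime lam (c.transversal (c.coord z)) = (c.param.symm z).1 :=
  h.siegelTime_eq (by rwa [c.linAct_transversal_coord hz])

variable [Nonempty (siegelStar lam)]

theorem siegelProj_transversal_coord (hz : z ∈ c.param.target) :
    siegelProj lam (c.transversal (c.coord z)) = siegelProj lam z := by
  rw [← siegelProj_linAct (c.param.symm z).1, c.linAct_transversal_coord hz]

variable (h : NonnegRelationsSpan (eigenvec lam))
include h

theorem coord_siegelProj_eventuallyEq (hz : z ∈ c.param.target) (hzs : z ∈ siegelStar lam) :
    (fun y => c.coord (siegelProj lam y)) =ᶠ[𝓝 z] c.coord := by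
  have hzS := siegelStar_subset_siegelSet hzs
  have hsymm : ContinuousAt c.param.symm z := c.param.symm.continuousAt hz
  have htime : siegelTime lam z = 0 := h.siegelTime_eq (by rwa [linAct_zero])
  have hshift : ContinuousAt
      (fun y => (siegelTime lam y + (c.param.symm y).1, (c.param.symm y).2)) z :=
    ((h.contDiffAt_siegelTime hzS).continuousAt.add hsymm.fst).prodMk hsymm.snd
  filter_upwards [h.isOpen_siegelSet.mem_nhds hzS, c.param.open_target.mem_nhds hz,
    hshift.preimage_mem_nhds (c.param.open_source.mem_nhds
      (by simpa [htime] using c.param.map_target hz))] with y hyS hy hys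
  rw [h.coe_siegelProj hyS, c.coord_linAct hy hys]

/-- The chart of `𝒯*` by the transversal coordinate of a foliated chart of `ℂⁿ`. -/
noncomputable def siegelStarChart : OpenPartialHomeomorph (siegelStar lam) (Cn (n - k)) where
  toFun w := c.coord w
  invFun x := siegelProj lam (c.transversal x)
  source := Subtype.val ⁻¹' c.param.target
  target := {x | c.transversal x ∈ siegelSet lam ∧
    (siegelTime lam (c.transversal x), x) ∈ c.param.source}
  map_source' w hw := by
    refine ⟨(linAct_mem_siegelSet lam (t := (c.param.symm w).1)).1 ?_, ?_⟩
    · rw [c.linAct_transversal_coord hw]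
      exact siegelStar_subset_siegelSet w.2
    · rw [c.siegelTime_transversal_coord h hw w.2]
      exact c.param.map_target hw
  map_target' x hx := by
    rw [Set.mem_preimage, h.coe_siegelProj hx.1, ← c.param_apply (_, x)]
    exact c.param.map_source hx.2
  left_inv' w hw := by rw [c.siegelProj_transversal_coord hw, h.siegelProj_coe]
  right_inv' x hx := by rw [h.coe_siegelProj hx.1, c.coord_linAct_transversal hx.2]
  open_source := c.param.open_target.preimage continuous_subtype_val
  open_target := by
    have hτ : Continuous c.transversal := c.contDiff_transversal.continuous
    have hcont : ContinuousOn (fun x => (siegelTime lam (c.transversal x), x))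
        (c.transversal ⁻¹' siegelSet lam) := fun x hx =>
      (((h.contDiffAt_siegelTime hx).continuousAt.comp hτ.continuousAt).prodMk
        continuousAt_id).continuousWithinAt
    exact hcont.isOpen_inter_preimage (h.isOpen_siegelSet.preimage hτ) c.param.open_source
  continuousOn_toFun w hw := ((c.contDiffAt_coord hw).continuousAt.comp
    continuous_subtype_val.continuousAt).continuousWithinAt
  continuousOn_invFun x hx := ((h.continuousAt_siegelProj hx.1).comp
    c.contDiff_transversal.continuous.continuousAt).continuousWithinAt

theorem isSubmersionChart_siegelStarChart :
    IsSubmersionChart ℂ ω (siegelSet lam) (siegelProj lam) (c.siegelStarChart h) where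
  contDiffAt z hz hzc := by
    set t := siegelTime lam z
    have hproj : (siegelProj lam z : Cn n) = linAct lam t z := h.coe_siegelProj hz
    have hzt : linAct lam t z ∈ c.param.target := hproj ▸ hzc
    have hcoord : ContDiffAt ℂ ω (fun y => c.coord (siegelProj lam y)) (linAct lam t z) :=
      (c.contDiffAt_coord hzt).congr_of_eventuallyEq
        (c.coord_siegelProj_eventuallyEq h hzt (hproj ▸ (siegelProj lam z).2))
    have hcomp := hcoord.comp z (contDiffAt_linAct (f := fun _ => t) contDiffAt_const contDiffAt_id)
    refine hcomp.congr_of_eventuallyEq (.of_forall fun y => ?_)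
    exact congrArg (fun w : siegelStar lam => c.coord w) (siegelProj_linAct t y).symm
  exists_section z hz hzc := by
    set t := siegelTime lam z
    set v : Cn n := (siegelProj lam z).1
    refine ⟨fun x => linAct lam (-t) (linAct lam (c.param.symm v).1 (c.transversal x)),
      contDiffAt_linAct contDiffAt_const
        (contDiffAt_linAct contDiffAt_const c.contDiff_transversal.contDiffAt), ?_, ?_⟩
    · change linAct lam (-t) (linAct lam (c.param.symm v).1 (c.transversal (c.coord v))) = z
      rw [c.linAct_transversal_coord hzc]
      exact (congrArg _ (h.coe_siegelProj hz)).trans (linAct_neg_linAct lam t z)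
    · exact .of_forall fun x => (siegelProj_linAct _ _).trans (siegelProj_linAct _ _)

end FoliatedChart

namespace NonnegRelationsSpan

variable (h : NonnegRelationsSpan (eigenvec lam))

include h in
theorem exists_foliatedChart (hw : w ∈ siegelStar lam) :
    ∃ c : FoliatedChart lam, w ∈ c.param.target :=
  exists_foliatedChart_of_injective_orbitDeriv (h.injective_orbitDeriv hw)

/-- The complex structure of `𝒯*` as the space of Siegel leaves: its charts are the transversal
coordinates of the foliated charts of `ℂⁿ`. -/
@[reducible]
noncomputable def siegelStarChartedSpace [Nonempty (siegelStar lam)] :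
    ChartedSpace (Cn (n - k)) (siegelStar lam) where
  atlas := Set.range fun c : FoliatedChart lam => c.siegelStarChart h
  chartAt w := (h.exists_foliatedChart w.2).choose.siegelStarChart h
  mem_chart_source w := (h.exists_foliatedChart w.2).choose_spec
  chart_mem_atlas _ := ⟨_, rfl⟩

variable [Nonempty (siegelStar lam)]

theorem isSubmersionChart_of_mem_atlas {φ : OpenPartialHomeomorph (siegelStar lam) (Cn (n - k))}
    (hφ : φ ∈ h.siegelStarChartedSpace.atlas) :
    IsSubmersionChart ℂ ω (siegelSet lam) (siegelProj lam) φ := by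
  obtain ⟨c, rfl⟩ := hφ
  exact c.isSubmersionChart_siegelStarChart h

theorem isSubmersionChart_chartAt (w : siegelStar lam) :
    IsSubmersionChart ℂ ω (siegelSet lam) (siegelProj lam) (h.siegelStarChartedSpace.chartAt w) :=
  h.isSubmersionChart_of_mem_atlas (h.siegelStarChartedSpace.chart_mem_atlas w)

theorem contMDiff_coe_siegelStar :
    letI := h.siegelStarChartedSpace
    ContMDiff 𝓘(ℝ, Cn (n - k)) 𝓘(ℝ, Cn n) ω (Subtype.val : siegelStar lam → Cn n) := by
  let _ := h.siegelStarChartedSpace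
  intro w
  have hw := siegelStar_subset_siegelSet w.2
  rw [← h.siegelProj_coe w]
  exact (h.isSubmersionChart_chartAt _).restrictScalars.contMDiffAt_of_comp hw
    continuous_subtype_val.continuousAt (h.contDiffAt_coe_siegelProj hw)

end NonnegRelationsSpan

end FoliatedCharts

theorem mainTheorem8 {n k : ℕ} (hk : 0 < k) (hkn : 2 * k < n)
    (lam : Matrix (Fin n) (Fin k) ℂ) (hrank : lam.rank = k) (hadm : IsAdmissible lam) :
    -- `Ψ` is a mixed map and a mixed ICIS
    (IsMixedMap (siegelMap lam) ∧ IsMixedICIS (siegelMap lam)) ∧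
    -- the Siegel leaves fill an open set, and every leaf through `𝒯*` is a Siegel leaf
    IsOpen (siegelSet lam) ∧
    ∃ hsub : siegelStar lam ⊆ siegelSet lam,
      -- `z ↦ leaf through z` is a homeomorphism from `𝒯*` to the space of Siegel leaves
      IsHomeomorph (fun z : siegelStar lam =>
        (Quotient.mk _ ⟨z, hsub z.2⟩ : SiegelLeafSpace lam)) ∧
      -- `𝒯*` has the structure of a complex manifold of dimension `n - k`
      ∃ _ : ChartedSpace (Cn (n - k)) (siegelStar lam),
        IsManifold 𝓘(ℂ, Cn (n - k)) ω (siegelStar lam) ∧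
        -- it is a smooth real submanifold of `ℂⁿ`
        ContMDiff 𝓘(ℝ, Cn (n - k)) 𝓘(ℝ, Cn n) ∞ (Subtype.val : siegelStar lam → Cn n) ∧
        (∀ z : siegelStar lam, Function.Injective
          (mfderiv 𝓘(ℝ, Cn (n - k)) 𝓘(ℝ, Cn n) (Subtype.val : siegelStar lam → Cn n) z)) ∧
        -- sending a point to the point of `𝒯*` on its leaf is a holomorphic submersion
        ∃ π : Cn n → siegelStar lam,
          (∀ z ∈ siegelSet lam, (π z : Cn n) ∈ leaf lam z) ∧
          ContMDiffOn 𝓘(ℂ, Cn n) 𝓘(ℂ, Cn (n - k)) ω π (siegelSet lam) ∧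
          ∀ z ∈ siegelSet lam, Function.Surjective
            (mfderiv 𝓘(ℂ, Cn n) 𝓘(ℂ, Cn (n - k)) π z) := by
  have h := hadm.weaklyHyperbolic.nonnegRelationsSpan hkn.le
  have : Nonempty (siegelStar lam) := (siegelStar_nonempty lam hadm.siegel).to_subtype
  let _ := h.siegelStarChartedSpace
  have hsub : siegelStar lam ⊆ siegelSet lam := siegelStar_subset_siegelSet
  refine ⟨⟨isMixedMap_siegelMap, isMixedICIS_siegelMap hk hkn hadm⟩, h.isOpen_siegelSet, hsub,
    h.isHomeomorph_leaf hsub, h.siegelStarChartedSpace, ?_, ?_, ?_, siegelProj lam,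
    fun _ => h.siegelProj_mem_leaf, ?_, ?_⟩
  · exact IsSubmersionChart.isManifold (fun _ => h.isSubmersionChart_of_mem_atlas)
      fun w _ => ⟨w, hsub w.2, h.siegelProj_coe w⟩
  · exact h.contMDiff_coe_siegelStar.of_le le_top
  · exact fun w => (h.isSubmersionChart_chartAt w).restrictScalars.injective_mfderiv_of_leftInverse
      h.siegelProj_coe (by simp) (hsub w.2) (h.contMDiff_coe_siegelStar w)
  · exact fun z hz => ((h.isSubmersionChart_chartAt _).contMDiffAt hz
      (h.continuousAt_siegelProj hz)).contMDiffWithinAt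
  · exact fun z hz => (h.isSubmersionChart_chartAt _).surjective_mfderiv (by simp) hz
      (h.continuousAt_siegelProj hz)
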